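/- Let $0<\gamma<1$ and $U_\gamma(x)=x^\gamma$ for $x\in[0,1]$. For every $n\ge 2$ the problem $$\max_{0\le r_n\le\cdots\le r_1\le 1}\ \sum_{1\le i<j\le n}U_\gamma(r_i-r_j)$$ has exactly one solution. If, for each $n\ge1$, $\hat{\mathbf r}_n=(\hat r_{n,1},\dots,\hat r_{n,n})$ is a solution of this problem, then the empirical distributions $\hat{\mathbb P}_n=\frac1n\sum_{i=1}^n\delta_{\hat r_{n,i}}$ converge weakly, as $n\to\infty$, to the Beta distribution $\mathrm{Beta}\left(\frac{1-\gamma}2,\frac{1-\gamma}2\right)$. This distribution has the probability density $$x\mapsto\frac1{B_\gamma}\,x^{-\frac{1+\gamma}2}(1-x)^{-\frac{1+\gamma}2}\ \text{ on }(0,1),\qquad B_\gamma=\int_0^1t^{-\frac{1+\gamma}2}(1-t)^{-\frac{1+\gamma}2}\,dt,$$ with respect to Lebesgue measure, and density $0$ outside $(0,1)$. -/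

import Mathlib

open MeasureTheory Filter Topology

namespace RewardCollapse

/-- The ordered reward vectors `1 ≥ r_1 ≥ ⋯ ≥ r_n ≥ 0` (indexed from `0` here). -/
def orderedRewards (n : ℕ) : Set (Fin n → ℝ) :=
  {r | Antitone r ∧ ∀ i, r i ∈ Set.Icc (0 : ℝ) 1}

/-- The overall utility `∑_{i < j} U (r_i - r_j)` of a reward vector. -/
noncomputable def totalUtility (U : ℝ → ℝ) {n : ℕ} (r : Fin n → ℝ) : ℝ :=
  ∑ i, ∑ j ∈ Finset.Ioi i, U (r i - r j)

/-- `r` solves the problem of maximizing the overall utility over ordered reward vectors. -/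
def IsOptimalReward (U : ℝ → ℝ) {n : ℕ} (r : Fin n → ℝ) : Prop :=
  r ∈ orderedRewards n ∧ IsMaxOn (totalUtility U) (orderedRewards n) r

/-- The measure `(1 / n) ∑_i δ_{r_i}` on the real line. -/
noncomputable def empiricalMeasure {n : ℕ} (r : Fin n → ℝ) : Measure ℝ :=
  (n : ENNReal)⁻¹ • ∑ i, Measure.dirac (r i)

theorem isProbabilityMeasure_empiricalMeasure {n : ℕ} [NeZero n] (r : Fin n → ℝ) :
    IsProbabilityMeasure (empiricalMeasure r) where
  measure_univ := by
    simp only [empiricalMeasure, Measure.smul_apply, Measure.finsetSum_apply, measure_univ,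
      Finset.sum_const, Finset.card_univ, Fintype.card_fin, nsmul_eq_mul, mul_one, smul_eq_mul]
    exact ENNReal.inv_mul_cancel (by exact_mod_cast NeZero.ne n) (ENNReal.natCast_ne_top n)

/-- The empirical distribution of a nonempty reward vector, as a probability measure. -/
noncomputable def empiricalDistribution {n : ℕ} [NeZero n] (r : Fin n → ℝ) :
    ProbabilityMeasure ℝ :=
  ⟨empiricalMeasure r, isProbabilityMeasure_empiricalMeasure r⟩

/-- The Beta distribution with positive parameters, as a probability measure. -/
noncomputable def betaDistribution (α β : ℝ) (hα : 0 < α) (hβ : 0 < β) : ProbabilityMeasure ℝ :=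
  ⟨ProbabilityTheory.betaMeasure α β, ProbabilityTheory.isProbabilityMeasureBeta hα hβ⟩

end RewardCollapse

/-! Uniqueness is strict concavity: the utility sees only differences of rewards, and the optimal
top reward is `1`, which removes the translation freedom.

For the limit, let `E(μ, ν)` be the mean of `|x - y|^γ`. Writing `|u|^γ` as an integral of `1 - cos
(t u)` against `t^(-1-γ)` turns `2 E(μ, ν) - E(μ, μ) - E(ν, ν)` into a weighted `L²` distance of
characteristic functions (`integral_norm_charFun_sub_sq`). The Beta law `β` has constant potential
`C` on `[0, 1]` (`integral_abs_sub_rpow_betaMeasure`), so for `ν = β` this distance is a multiple of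
`C - E(μ, μ)`. Independent samples from `β` show that an optimal vector of length `n` satisfies
`E(μ, μ) ≥ (1 - 1/n) C` (`IsOptimalReward.energy_le`). The distance is thus `O(1/n)`; as the
characteristic functions are Lipschitz, it controls them pointwise
(`norm_charFun_sub_pow_three_le`), and Lévy's continuity theorem concludes. -/

namespace RewardCollapse

/-! ### Cosine representation of `|u|^γ` -/

/-- A dominating function for `(1 - cos (t u)) t^(-1-γ)`, uniform in `|u| ≤ 1`: the bound `t^2`
serves near `0`, the bound `2` at infinity. -/
theorem integrableOn_min_two_sq_mul_rpow {γ : ℝ} (hγ₀ : 0 < γ) (hγ₁ : γ < 1) :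
    IntegrableOn (fun t : ℝ => min 2 (t ^ 2) * t ^ (-1 - γ)) (Set.Ioi 0) := by
  have hmeas : Measurable (fun t : ℝ => min 2 (t ^ 2) * t ^ (-1 - γ)) := by fun_prop
  rw [← Set.Ioc_union_Ioi_eq_Ioi (zero_le_one' ℝ)]
  refine IntegrableOn.union ?_ ?_
  · have h : IntegrableOn (fun t : ℝ => t ^ (1 - γ)) (Set.Ioc 0 1) :=
      (intervalIntegrable_iff_integrableOn_Ioc_of_le zero_le_one).1
        (intervalIntegral.intervalIntegrable_rpow' (by linarith))
    refine Integrable.mono' h hmeas.aestronglyMeasurable ?_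
    refine (ae_restrict_iff' measurableSet_Ioc).2 (Eventually.of_forall fun t ht => ?_)
    have ht0 : 0 < t := ht.1
    rw [Real.norm_of_nonneg (by positivity)]
    calc min 2 (t ^ 2) * t ^ (-1 - γ) ≤ t ^ 2 * t ^ (-1 - γ) := by
          gcongr; exact min_le_right _ _
      _ = t ^ (1 - γ) := by
          rw [← Real.rpow_natCast, ← Real.rpow_add ht0]; congr 1; push_cast; ring
  · have h : IntegrableOn (fun t : ℝ => 2 * t ^ (-1 - γ)) (Set.Ioi 1) :=
      (integrableOn_Ioi_rpow_of_lt (by linarith) one_pos).const_mul 2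
    refine Integrable.mono' h hmeas.aestronglyMeasurable ?_
    refine (ae_restrict_iff' measurableSet_Ioi).2 (Eventually.of_forall fun t ht => ?_)
    have ht0 : 0 < t := one_pos.trans ht
    rw [Real.norm_of_nonneg (by positivity)]
    gcongr
    exact min_le_left _ _

theorem one_sub_cos_mul_le_min {t u : ℝ} (hu : |u| ≤ 1) :
    1 - Real.cos (t * u) ≤ min 2 (t ^ 2) := by
  refine le_min (by linarith [Real.neg_one_le_cos (t * u)]) ?_
  have h1 := Real.one_sub_sq_div_two_le_cos (x := t * u)
  have h2 : u ^ 2 ≤ 1 := (sq_le_one_iff_abs_le_one u).2 hu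
  have h3 : (t * u) ^ 2 ≤ t ^ 2 := by
    rw [mul_pow]; exact mul_le_of_le_one_right (sq_nonneg t) h2
  nlinarith [sq_nonneg (t * u)]

/-- The constant `∫₀^∞ (1 - cos t) t^(-1-γ) dt`. -/
noncomputable def cosConstant (γ : ℝ) : ℝ :=
  ∫ t in Set.Ioi (0 : ℝ), (1 - Real.cos t) * t ^ (-1 - γ)

theorem integrableOn_one_sub_cos_mul_rpow {γ : ℝ} (hγ₀ : 0 < γ) (hγ₁ : γ < 1) :
    IntegrableOn (fun t : ℝ => (1 - Real.cos t) * t ^ (-1 - γ)) (Set.Ioi 0) := by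
  have hmeas : Measurable (fun t : ℝ => (1 - Real.cos t) * t ^ (-1 - γ)) := by fun_prop
  refine Integrable.mono' (integrableOn_min_two_sq_mul_rpow hγ₀ hγ₁) hmeas.aestronglyMeasurable ?_
  refine (ae_restrict_iff' measurableSet_Ioi).2 (Eventually.of_forall fun t ht => ?_)
  have ht0 : 0 < t := ht
  rw [Real.norm_of_nonneg (mul_nonneg (by linarith [Real.cos_le_one t]) (by positivity))]
  gcongr
  simpa using one_sub_cos_mul_le_min (t := t) (u := 1) (by simp)

theorem cosConstant_pos {γ : ℝ} (hγ₀ : 0 < γ) (hγ₁ : γ < 1) : 0 < cosConstant γ := by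
  unfold cosConstant
  rw [setIntegral_pos_iff_support_of_nonneg_ae ?_ (integrableOn_one_sub_cos_mul_rpow hγ₀ hγ₁)]
  · refine lt_of_lt_of_le ?_ (measure_mono (s := Set.Ioo (0 : ℝ) 1) ?_)
    · simp
    · intro t ht
      refine ⟨?_, ht.1⟩
      have h1 : Real.cos t < 1 := by
        have := Real.cos_lt_cos_of_nonneg_of_le_pi_div_two (x := 0) (y := t) le_rfl
          (by linarith [Real.pi_gt_three, ht.2]) ht.1
        simpa using this
      have h2 : 0 < t ^ (-1 - γ) := Real.rpow_pos_of_pos ht.1 _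
      exact (mul_pos (sub_pos.2 h1) h2).ne'
  · refine (ae_restrict_iff' measurableSet_Ioi).2 (Eventually.of_forall fun t ht => ?_)
    have ht0 : 0 < t := ht
    exact mul_nonneg (by linarith [Real.cos_le_one t]) (by positivity)

/-- Rescaling `t` by `|u|` extracts the power of `|u|`. -/
theorem integral_one_sub_cos_mul_mul_rpow {γ : ℝ} (hγ₀ : 0 < γ) (u : ℝ) :
    ∫ t in Set.Ioi (0 : ℝ), (1 - Real.cos (t * u)) * t ^ (-1 - γ) = cosConstant γ * |u| ^ γ := by
  rcases eq_or_ne u 0 with rfl | hu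
  · simp [Real.zero_rpow hγ₀.ne']
  have ha : 0 < |u| := abs_pos.2 hu
  have h := integral_comp_mul_left_Ioi (fun t : ℝ => (1 - Real.cos t) * t ^ (-1 - γ)) 0 ha
  rw [mul_zero, smul_eq_mul] at h
  have h2 : ∫ t in Set.Ioi (0 : ℝ), (1 - Real.cos (t * u)) * t ^ (-1 - γ) =
      ∫ t in Set.Ioi (0 : ℝ), |u| ^ (1 + γ) *
        ((1 - Real.cos (|u| * t)) * (|u| * t) ^ (-1 - γ)) := by
    refine setIntegral_congr_fun measurableSet_Ioi fun t ht => ?_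
    have ht0 : 0 < t := ht
    have hc : Real.cos (t * u) = Real.cos (|u| * t) := by
      rw [← Real.cos_abs (t * u), abs_mul, abs_of_pos ht0, mul_comm]
    simp only [hc]
    rw [Real.mul_rpow ha.le ht0.le]
    have : |u| ^ (1 + γ) * |u| ^ (-1 - γ) = 1 := by
      rw [← Real.rpow_add ha]; simp
    linear_combination (-(1 - Real.cos (|u| * t)) * t ^ (-1 - γ)) * this
  rw [h2, integral_const_mul, h, Real.rpow_add ha, Real.rpow_one, cosConstant]
  field_simp

/-! ### Energy distance and characteristic functions -/

/-- The mutual `γ`-energy of two measures. -/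
noncomputable def energy (γ : ℝ) (μ ν : Measure ℝ) : ℝ :=
  ∫ p, |p.1 - p.2| ^ γ ∂(μ.prod ν)

theorem ae_prod_abs_sub_le_one {μ ν : Measure ℝ} (hμ : ∀ᵐ x ∂μ, x ∈ Set.Icc (0 : ℝ) 1)
    (hν : ∀ᵐ x ∂ν, x ∈ Set.Icc (0 : ℝ) 1) : ∀ᵐ p ∂(μ.prod ν), |p.1 - p.2| ≤ 1 := by
  have h1 : ∀ᵐ p ∂(μ.prod ν), p.1 ∈ Set.Icc (0 : ℝ) 1 :=
    Measure.quasiMeasurePreserving_fst.ae hμ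
  have h2 : ∀ᵐ p ∂(μ.prod ν), p.2 ∈ Set.Icc (0 : ℝ) 1 :=
    Measure.quasiMeasurePreserving_snd.ae hν
  filter_upwards [h1, h2] with p hp hq
  rw [abs_le]
  constructor <;> linarith [hp.1, hp.2, hq.1, hq.2]

section Energy

variable {γ : ℝ} {μ ν : Measure ℝ} [IsProbabilityMeasure μ] [IsProbabilityMeasure ν]

theorem integrable_one_sub_cos_prod (hγ₀ : 0 < γ) (hγ₁ : γ < 1)
    (hμ : ∀ᵐ x ∂μ, x ∈ Set.Icc (0 : ℝ) 1) (hν : ∀ᵐ x ∂ν, x ∈ Set.Icc (0 : ℝ) 1) :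
    Integrable (fun q : ℝ × (ℝ × ℝ) =>
      (1 - Real.cos (q.1 * (q.2.1 - q.2.2))) * q.1 ^ (-1 - γ))
      ((volume.restrict (Set.Ioi 0)).prod (μ.prod ν)) := by
  have hmeas : Measurable (fun q : ℝ × (ℝ × ℝ) =>
      (1 - Real.cos (q.1 * (q.2.1 - q.2.2))) * q.1 ^ (-1 - γ)) := by fun_prop
  have hdom : Integrable (fun q : ℝ × (ℝ × ℝ) => min 2 (q.1 ^ 2) * q.1 ^ (-1 - γ))
      ((volume.restrict (Set.Ioi 0)).prod (μ.prod ν)) :=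
    Integrable.comp_fst (integrableOn_min_two_sq_mul_rpow hγ₀ hγ₁) (μ.prod ν)
  refine hdom.mono' hmeas.aestronglyMeasurable ?_
  have h1 : ∀ᵐ q ∂((volume.restrict (Set.Ioi (0 : ℝ))).prod (μ.prod ν)), q.1 ∈ Set.Ioi (0 : ℝ) :=
    Measure.quasiMeasurePreserving_fst.ae (ae_restrict_mem measurableSet_Ioi)
  have h2 : ∀ᵐ q ∂((volume.restrict (Set.Ioi (0 : ℝ))).prod (μ.prod ν)), |q.2.1 - q.2.2| ≤ 1 :=
    Measure.quasiMeasurePreserving_snd.ae (ae_prod_abs_sub_le_one hμ hν)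
  filter_upwards [h1, h2] with q hq hq2
  have hq0 : 0 < q.1 := hq
  rw [Real.norm_of_nonneg (mul_nonneg (by linarith [Real.cos_le_one (q.1 * (q.2.1 - q.2.2))])
    (by positivity))]
  gcongr
  exact one_sub_cos_mul_le_min hq2

theorem integrableOn_integral_one_sub_cos (hγ₀ : 0 < γ) (hγ₁ : γ < 1)
    (hμ : ∀ᵐ x ∂μ, x ∈ Set.Icc (0 : ℝ) 1) (hν : ∀ᵐ x ∂ν, x ∈ Set.Icc (0 : ℝ) 1) :
    IntegrableOn (fun t : ℝ => (∫ p, (1 - Real.cos (t * (p.1 - p.2))) ∂(μ.prod ν)) *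
      t ^ (-1 - γ)) (Set.Ioi 0) := by
  have h := (integrable_one_sub_cos_prod hγ₀ hγ₁ hμ hν).integral_prod_left
  simp only [integral_mul_const] at h
  exact h

theorem integral_integral_one_sub_cos (hγ₀ : 0 < γ) (hγ₁ : γ < 1)
    (hμ : ∀ᵐ x ∂μ, x ∈ Set.Icc (0 : ℝ) 1) (hν : ∀ᵐ x ∂ν, x ∈ Set.Icc (0 : ℝ) 1) :
    ∫ t in Set.Ioi (0 : ℝ), (∫ p, (1 - Real.cos (t * (p.1 - p.2))) ∂(μ.prod ν)) * t ^ (-1 - γ) =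
      cosConstant γ * energy γ μ ν := by
  have h := integral_integral_swap (f := fun (t : ℝ) (p : ℝ × ℝ) =>
    (1 - Real.cos (t * (p.1 - p.2))) * t ^ (-1 - γ)) (integrable_one_sub_cos_prod hγ₀ hγ₁ hμ hν)
  simp only [integral_mul_const] at h
  rw [h]
  simp only [integral_one_sub_cos_mul_mul_rpow hγ₀, integral_const_mul]
  rfl

theorem charFun_eq_cos_add_sin (t : ℝ) :
    charFun μ t = (∫ x, Real.cos (t * x) ∂μ : ℝ) + (∫ x, Real.sin (t * x) ∂μ : ℝ) * Complex.I := by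
  have hc : Integrable (fun x => Real.cos (t * x)) μ :=
    Integrable.of_bound (C := 1) (by fun_prop) (Eventually.of_forall fun x => Real.abs_cos_le_one _)
  have hs : Integrable (fun x => Real.sin (t * x)) μ :=
    Integrable.of_bound (C := 1) (by fun_prop) (Eventually.of_forall fun x => Real.abs_sin_le_one _)
  rw [charFun_apply_real, ← integral_complex_ofReal, ← integral_complex_ofReal,
    ← integral_mul_const, ← integral_add hc.ofReal (hs.ofReal.mul_const _)]
  refine integral_congr_ae (Eventually.of_forall fun x => ?_)
  simp only [Complex.exp_mul_I]
  push_cast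
  rfl

theorem integral_one_sub_cos_prod (t : ℝ) :
    ∫ p, (1 - Real.cos (t * (p.1 - p.2))) ∂(μ.prod ν) =
      1 - ((∫ x, Real.cos (t * x) ∂μ) * (∫ x, Real.cos (t * x) ∂ν) +
        (∫ x, Real.sin (t * x) ∂μ) * (∫ x, Real.sin (t * x) ∂ν)) := by
  have hc (ρ : Measure ℝ) [IsProbabilityMeasure ρ] : Integrable (fun x => Real.cos (t * x)) ρ :=
    Integrable.of_bound (C := 1) (by fun_prop) (Eventually.of_forall fun x => Real.abs_cos_le_one _)
  have hs (ρ : Measure ℝ) [IsProbabilityMeasure ρ] : Integrable (fun x => Real.sin (t * x)) ρ :=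
    Integrable.of_bound (C := 1) (by fun_prop) (Eventually.of_forall fun x => Real.abs_sin_le_one _)
  rw [← integral_prod_mul, ← integral_prod_mul,
    ← integral_add ((hc μ).mul_prod (hc ν)) ((hs μ).mul_prod (hs ν))]
  rw [integral_sub (integrable_const _)]
  · simp [mul_sub, Real.cos_sub]
  · exact Integrable.of_bound (C := 1) (by fun_prop)
      (Eventually.of_forall fun x => Real.abs_cos_le_one _)

/-- The integral of `cos (t (x - y))` is the real part of one characteristic function times the
conjugate of the other; the constants cancel as `2 - 1 - 1 = 0`. -/
theorem norm_charFun_sub_sq (t : ℝ) :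
    ‖charFun μ t - charFun ν t‖ ^ 2 =
      2 * (∫ p, (1 - Real.cos (t * (p.1 - p.2))) ∂(μ.prod ν)) -
        (∫ p, (1 - Real.cos (t * (p.1 - p.2))) ∂(μ.prod μ)) -
        (∫ p, (1 - Real.cos (t * (p.1 - p.2))) ∂(ν.prod ν)) := by
  simp only [integral_one_sub_cos_prod, charFun_eq_cos_add_sin]
  rw [← Complex.normSq_eq_norm_sq, Complex.normSq_apply]
  simp
  ring

theorem integrableOn_norm_charFun_sub_sq (hγ₀ : 0 < γ) (hγ₁ : γ < 1)
    (hμ : ∀ᵐ x ∂μ, x ∈ Set.Icc (0 : ℝ) 1) (hν : ∀ᵐ x ∂ν, x ∈ Set.Icc (0 : ℝ) 1) :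
    IntegrableOn (fun t : ℝ => ‖charFun μ t - charFun ν t‖ ^ 2 * t ^ (-1 - γ)) (Set.Ioi 0) := by
  have h := (((integrableOn_integral_one_sub_cos hγ₀ hγ₁ hμ hν).const_mul 2).sub
    (integrableOn_integral_one_sub_cos hγ₀ hγ₁ hμ hμ)).sub
    (integrableOn_integral_one_sub_cos hγ₀ hγ₁ hν hν)
  refine h.congr (Eventually.of_forall fun t => ?_)
  simp only [norm_charFun_sub_sq, Pi.sub_apply]
  ring

theorem integral_norm_charFun_sub_sq (hγ₀ : 0 < γ) (hγ₁ : γ < 1)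
    (hμ : ∀ᵐ x ∂μ, x ∈ Set.Icc (0 : ℝ) 1) (hν : ∀ᵐ x ∂ν, x ∈ Set.Icc (0 : ℝ) 1) :
    ∫ t in Set.Ioi (0 : ℝ), ‖charFun μ t - charFun ν t‖ ^ 2 * t ^ (-1 - γ) =
      cosConstant γ * (2 * energy γ μ ν - energy γ μ μ - energy γ ν ν) := by
  have h1 := integrableOn_integral_one_sub_cos hγ₀ hγ₁ hμ hν
  have h2 := integrableOn_integral_one_sub_cos hγ₀ hγ₁ hμ hμ
  have h3 := integrableOn_integral_one_sub_cos hγ₀ hγ₁ hν hν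
  simp only [norm_charFun_sub_sq, sub_mul, mul_assoc]
  rw [integral_sub (by exact (h1.const_mul 2).sub h2) h3, integral_sub (h1.const_mul 2) h2,
    integral_const_mul, integral_integral_one_sub_cos hγ₀ hγ₁ hμ hν,
    integral_integral_one_sub_cos hγ₀ hγ₁ hμ hμ, integral_integral_one_sub_cos hγ₀ hγ₁ hν hν]
  ring

/-- The phase `t x` is `1`-Lipschitz in `t` because `0 ≤ x ≤ 1`. -/
theorem norm_charFun_sub_charFun_le (hμ : ∀ᵐ x ∂μ, x ∈ Set.Icc (0 : ℝ) 1) (s t : ℝ) :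
    ‖charFun μ s - charFun μ t‖ ≤ |s - t| := by
  have hi (t : ℝ) : Integrable (fun x : ℝ => Complex.exp (t * x * Complex.I)) μ :=
    Integrable.of_bound (C := 1) (by fun_prop) (Eventually.of_forall fun x => by
      rw [← Complex.ofReal_mul, Complex.norm_exp_ofReal_mul_I])
  rw [charFun_apply_real, charFun_apply_real, ← integral_sub (hi s) (hi t)]
  have := norm_integral_le_of_norm_le_const (μ := μ) (C := |s - t|)
    (f := fun x : ℝ => Complex.exp (s * x * Complex.I) - Complex.exp (t * x * Complex.I)) ?_
  · simpa using this
  filter_upwards [hμ] with x hx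
  have e : Complex.exp (s * x * Complex.I) - Complex.exp (t * x * Complex.I) =
      Complex.exp ((t * x : ℝ) * Complex.I) *
        (Complex.exp (Complex.I * ((s - t) * x : ℝ)) - 1) := by
    rw [mul_sub, ← Complex.exp_add]
    push_cast
    congr 1
    · congr 1; ring
    · simp
  rw [e, norm_mul, Complex.norm_exp_ofReal_mul_I, one_mul]
  refine (Real.norm_exp_I_mul_ofReal_sub_one_le).trans ?_
  rw [Real.norm_eq_abs, abs_mul, abs_of_nonneg hx.1]
  exact mul_le_of_le_one_right (abs_nonneg _) hx.2

/-- The energy distance controls the distance of the characteristic functions. -/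
theorem norm_charFun_sub_pow_three_le (hγ₀ : 0 < γ) (hγ₁ : γ < 1)
    (hμ : ∀ᵐ x ∂μ, x ∈ Set.Icc (0 : ℝ) 1) (hν : ∀ᵐ x ∂ν, x ∈ Set.Icc (0 : ℝ) 1)
    {t : ℝ} (ht : 0 < t) :
    ‖charFun μ t - charFun ν t‖ ^ 3 ≤ 16 * (t + 1) ^ (1 + γ) *
      (cosConstant γ * (2 * energy γ μ ν - energy γ μ μ - energy γ ν ν)) := by
  rw [← integral_norm_charFun_sub_sq hγ₀ hγ₁ hμ hν]
  set e := ‖charFun μ t - charFun ν t‖ with he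
  have he0 : 0 ≤ e := norm_nonneg _
  have he2 : e ≤ 2 := by
    refine (norm_sub_le _ _).trans ?_
    linarith [norm_charFun_le_one (μ := μ) t, norm_charFun_le_one (μ := ν) t]
  have hint := integrableOn_norm_charFun_sub_sq hγ₀ hγ₁ hμ hν
  -- Over a length `e / 4` the difference of two `1`-Lipschitz functions loses at most `e / 2`, so
  -- it keeps norm at least `e / 2`; and `e ≤ 2` keeps the interval below `t + 1`.
  have hsub : Set.Ioc t (t + e / 4) ⊆ Set.Ioi 0 := fun s hs => ht.trans hs.1
  have hlow : ∀ s ∈ Set.Ioc t (t + e / 4),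
      e ^ 2 / 4 * (t + 1) ^ (-1 - γ) ≤ ‖charFun μ s - charFun ν s‖ ^ 2 * s ^ (-1 - γ) := by
    intro s hs
    have hs0 : 0 < s := ht.trans hs.1
    have h1 := norm_charFun_sub_charFun_le hμ s t
    have h2 := norm_charFun_sub_charFun_le hν s t
    rw [abs_of_nonneg (by linarith [hs.1])] at h1 h2
    have h3 : e ≤ ‖charFun μ s - charFun ν s‖ + ‖charFun μ s - charFun μ t‖ +
        ‖charFun ν s - charFun ν t‖ := by
      have : charFun μ t - charFun ν t = (charFun μ s - charFun ν s) -
        (charFun μ s - charFun μ t) + (charFun ν s - charFun ν t) := by ring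
      rw [he, this]
      exact (norm_add_le _ _).trans (add_le_add_left (norm_sub_le _ _) _)
    have h4 : e / 2 ≤ ‖charFun μ s - charFun ν s‖ := by linarith [hs.2]
    have h5 : (t + 1) ^ (-1 - γ) ≤ s ^ (-1 - γ) :=
      Real.rpow_le_rpow_of_nonpos hs0 (by linarith [hs.2]) (by linarith)
    have h6 : e ^ 2 / 4 ≤ ‖charFun μ s - charFun ν s‖ ^ 2 := by nlinarith
    gcongr
  have hI : e / 4 * (e ^ 2 / 4 * (t + 1) ^ (-1 - γ)) ≤
      ∫ t in Set.Ioi (0 : ℝ), ‖charFun μ t - charFun ν t‖ ^ 2 * t ^ (-1 - γ) := by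
    refine le_trans ?_ (setIntegral_mono_set hint ?_ hsub.eventuallyLE)
    · have := setIntegral_ge_of_const_le_real measurableSet_Ioc (by simp) hlow (hint.mono_set hsub)
      simp only [Measure.real, Real.volume_Ioc, add_sub_cancel_left] at this
      rw [ENNReal.toReal_ofReal (by positivity)] at this
      linarith
    · refine (ae_restrict_iff' measurableSet_Ioi).2 (Eventually.of_forall fun s hs => ?_)
      have hs0 : 0 < s := hs
      simp only [Pi.zero_apply]
      positivity
  have hone : (t + 1) ^ (1 + γ) * (t + 1) ^ (-1 - γ) = 1 := by
    rw [← Real.rpow_add (by linarith)]; simp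
  calc e ^ 3 = 16 * (t + 1) ^ (1 + γ) * (e / 4 * (e ^ 2 / 4 * (t + 1) ^ (-1 - γ))) := by
        linear_combination (-e ^ 3) * hone
    _ ≤ _ := by gcongr

end Energy

/-! ### The odd kernel and the projective involution -/

/-- The odd power kernel `sgn(u) |u|^(γ-1)`. -/
noncomputable def oddKernel (γ u : ℝ) : ℝ := Real.sign u * |u| ^ (γ - 1)

theorem measurable_real_sign : Measurable Real.sign := by
  have : Real.sign = fun r : ℝ => if r < 0 then (-1 : ℝ) else if 0 < r then 1 else 0 := by
    funext r; rfl
  rw [this]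
  exact Measurable.ite measurableSet_Iio measurable_const
    (Measurable.ite measurableSet_Ioi measurable_const measurable_const)

theorem measurable_oddKernel (γ : ℝ) : Measurable (oddKernel γ) :=
  measurable_real_sign.mul (by fun_prop)

theorem norm_oddKernel_le (γ u : ℝ) : ‖oddKernel γ u‖ ≤ |u| ^ (γ - 1) := by
  rw [oddKernel, norm_mul, Real.norm_of_nonneg (by positivity : 0 ≤ |u| ^ (γ - 1))]
  refine mul_le_of_le_one_left (by positivity) ?_
  rcases Real.sign_apply_eq u with h | h | h <;> simp [h]

theorem oddKernel_neg_mul (γ u : ℝ) {c : ℝ} (hc : 0 < c) :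
    oddKernel γ (-(c * u)) = -(c ^ (γ - 1) * oddKernel γ u) := by
  have h : Real.sign (c * u) = Real.sign u := by
    rcases lt_trichotomy u 0 with h | rfl | h
    · rw [Real.sign_of_neg h, Real.sign_of_neg (mul_neg_of_pos_of_neg hc h)]
    · simp
    · rw [Real.sign_of_pos h, Real.sign_of_pos (mul_pos hc h)]
  rw [oddKernel, oddKernel, Real.sign_neg, h, abs_neg, abs_mul, abs_of_pos hc,
    Real.mul_rpow hc.le (abs_nonneg u)]
  ring

theorem locallyIntegrable_oddKernel {γ : ℝ} (hγ₀ : 0 < γ) :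
    LocallyIntegrable (oddKernel γ) := by
  refine locallyIntegrable_of_norm_le_rpow (C := 1) (α := 1 - γ) (by simp)
    (by simpa using hγ₀) (Eventually.of_forall fun u => ?_)
    (measurable_oddKernel γ).aestronglyMeasurable
  simpa using norm_oddKernel_le γ u

/-- The fundamental theorem of calculus, with the single exceptional point `s = y`. -/
theorem integral_oddKernel_sub {γ : ℝ} (hγ₀ : 0 < γ) (x y : ℝ) :
    γ * ∫ s in (0 : ℝ)..x, oddKernel γ (s - y) = |x - y| ^ γ - |y| ^ γ := by
  have hI : IntervalIntegrable (fun s => γ * oddKernel γ (s - y)) volume 0 x := by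
    refine IntervalIntegrable.const_mul ?_ γ
    have h : IntervalIntegrable (oddKernel γ) volume (0 - y) (x - y) :=
      intervalIntegrable_iff.2 (((locallyIntegrable_oddKernel hγ₀).integrableOn_isCompact
        isCompact_uIcc).mono_set Set.uIoc_subset_uIcc)
    simpa using h.comp_sub_right y
  have hc : Continuous (fun s : ℝ => |s - y| ^ γ) :=
    (continuous_abs.comp (continuous_id.sub continuous_const)).rpow_const fun _ => Or.inr hγ₀.le
  have h := MeasureTheory.integral_eq_of_hasDerivAt_off_countable (fun s : ℝ => |s - y| ^ γ)
    (fun s => γ * oddKernel γ (s - y)) (s := {y}) (Set.countable_singleton y)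
    hc.continuousOn (fun s hs => ?_) hI
  · rw [← intervalIntegral.integral_const_mul, h]
    simp
  · have hne : s - y ≠ 0 := sub_ne_zero.2 fun h => hs.2 h
    have hd := ((hasDerivAt_abs hne).comp s ((hasDerivAt_id s).sub_const y)).rpow_const
      (p := γ) (Or.inl (by simpa using hne))
    refine hd.congr_deriv ?_
    rcases lt_or_gt_of_ne hne with h | h
    · simp [oddKernel, Real.sign_of_neg h, h]
    · simp [oddKernel, Real.sign_of_pos h, h]

/-- The projective involution of `(0, 1)` that swaps the endpoints and fixes `1 / (1 + q)`. -/
noncomputable def swapEnds (q z : ℝ) : ℝ := (1 - z) / (1 - z + z * q ^ 2)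

theorem swapEnds_denom_pos {q z : ℝ} (hq : 0 < q) (hz : z ∈ Set.Ioo (0 : ℝ) 1) :
    0 < 1 - z + z * q ^ 2 :=
  add_pos (sub_pos.2 hz.2) (mul_pos hz.1 (by positivity))

theorem one_sub_swapEnds {q z : ℝ} (hq : 0 < q) (hz : z ∈ Set.Ioo (0 : ℝ) 1) :
    1 - swapEnds q z = z * q ^ 2 / (1 - z + z * q ^ 2) := by
  have := (swapEnds_denom_pos hq hz).ne'
  rw [swapEnds, eq_div_iff this, sub_mul, div_mul_cancel₀ _ this]
  ring

theorem swapEnds_mem {q z : ℝ} (hq : 0 < q) (hz : z ∈ Set.Ioo (0 : ℝ) 1) :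
    swapEnds q z ∈ Set.Ioo (0 : ℝ) 1 := by
  refine ⟨div_pos (sub_pos.2 hz.2) (swapEnds_denom_pos hq hz), ?_⟩
  rw [← sub_pos, one_sub_swapEnds hq hz]
  exact div_pos (mul_pos hz.1 (by positivity)) (swapEnds_denom_pos hq hz)

theorem swapEnds_swapEnds {q z : ℝ} (hq : 0 < q) (hz : z ∈ Set.Ioo (0 : ℝ) 1) :
    swapEnds q (swapEnds q z) = z := by
  have hD := (swapEnds_denom_pos hq hz).ne'
  rw [swapEnds, one_sub_swapEnds hq hz, swapEnds]
  field_simp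
  ring

theorem hasDerivAt_swapEnds {q z : ℝ} (hq : 0 < q) (hz : z ∈ Set.Ioo (0 : ℝ) 1) :
    HasDerivAt (swapEnds q) (-(q ^ 2 / (1 - z + z * q ^ 2) ^ 2)) z := by
  have h1 : HasDerivAt (fun z : ℝ => 1 - z) (-1) z := (hasDerivAt_id z).const_sub 1
  have h2 := h1.add ((hasDerivAt_id z).mul_const (q ^ 2))
  refine (h1.div h2 (swapEnds_denom_pos hq hz).ne').congr_deriv ?_
  simp only [Pi.add_apply, id]
  have hD := (swapEnds_denom_pos hq hz).ne'
  field_simp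
  ring

theorem image_swapEnds {q : ℝ} (hq : 0 < q) :
    swapEnds q '' Set.Ioo (0 : ℝ) 1 = Set.Ioo 0 1 := by
  refine Set.Subset.antisymm ?_ fun z hz => ⟨swapEnds q z, swapEnds_mem hq hz,
    swapEnds_swapEnds hq hz⟩
  rintro _ ⟨z, hz, rfl⟩
  exact swapEnds_mem hq hz

/-- The derivative of the potential of the Beta weight vanishes inside `(0, 1)`. -/
theorem integral_rpow_mul_oddKernel_eq_zero (γ : ℝ) {s : ℝ} (hs : s ∈ Set.Ioo (0 : ℝ) 1) :
    ∫ y in Set.Ioo (0 : ℝ) 1,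
      y ^ (-(1 + γ) / 2) * (1 - y) ^ (-(1 + γ) / 2) * oddKernel γ (s - y) = 0 := by
  set a : ℝ := -(1 + γ) / 2 with ha
  -- This `q` makes `s` the fixed point of `swapEnds q`.
  obtain ⟨q, hq, rfl⟩ : ∃ q : ℝ, 0 < q ∧ s = 1 / (1 + q) := by
    refine ⟨(1 - s) / s, div_pos (sub_pos.2 hs.2) hs.1, ?_⟩
    have := hs.1.ne'
    field_simp
    ring
  have hcv := integral_image_eq_integral_abs_deriv_smul (s := Set.Ioo (0 : ℝ) 1)
    (f := swapEnds q) measurableSet_Ioo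
    (fun z hz => (hasDerivAt_swapEnds hq hz).hasDerivWithinAt)
    (fun z hz z' hz' h => by rw [← swapEnds_swapEnds hq hz, h, swapEnds_swapEnds hq hz'])
    (fun y => y ^ a * (1 - y) ^ a * oddKernel γ (1 / (1 + q) - y))
  rw [image_swapEnds hq] at hcv
  -- The involution, with its Jacobian, turns the integrand into its negative, so the integral
  -- equals its own opposite; no integrability is needed.
  have hpt : ∀ z ∈ Set.Ioo (0 : ℝ) 1, |-(q ^ 2 / (1 - z + z * q ^ 2) ^ 2)| •
      (swapEnds q z ^ a * (1 - swapEnds q z) ^ a * oddKernel γ (1 / (1 + q) - swapEnds q z)) =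
      -(z ^ a * (1 - z) ^ a * oddKernel γ (1 / (1 + q) - z)) := by
    intro z hz
    have hD := swapEnds_denom_pos hq hz
    have hk : 1 / (1 + q) - swapEnds q z =
        -(q / (1 - z + z * q ^ 2) * (1 / (1 + q) - z)) := by
      have hD' := hD.ne'
      have hq' : 1 + q ≠ 0 := by positivity
      rw [swapEnds]
      generalize hDef : 1 - z + z * q ^ 2 = D at hD' ⊢
      field_simp
      rw [← hDef]
      ring
    rw [hk, oddKernel_neg_mul γ _ (div_pos hq hD), one_sub_swapEnds hq hz, swapEnds]
    set D := 1 - z + z * q ^ 2 with hDdef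
    have hz0 := hz.1
    have hz1 : 0 < 1 - z := sub_pos.2 hz.2
    rw [abs_neg, abs_of_pos (by positivity), smul_eq_mul, Real.div_rpow hz1.le hD.le,
      Real.div_rpow (by positivity) hD.le, Real.mul_rpow hz0.le (by positivity),
      Real.div_rpow hq.le hD.le]
    -- The powers of `q` and of `D` both cancel because `2 + 2 a + (γ - 1) = 0`, which singles out
    -- the Beta exponent `a`.
    have e1 : q ^ 2 * (q ^ 2) ^ a * q ^ (γ - 1) = 1 := by
      rw [← Real.rpow_natCast, ← Real.rpow_mul hq.le, ← Real.rpow_add hq, ← Real.rpow_add hq, ha]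
      push_cast
      ring_nf
      simp
    have e2 : D ^ 2 * D ^ a * D ^ a * D ^ (γ - 1) = 1 := by
      rw [← Real.rpow_natCast, ← Real.rpow_add hD, ← Real.rpow_add hD, ← Real.rpow_add hD, ha]
      push_cast
      ring_nf
      simp
    have h1 : D ^ a ≠ 0 := (Real.rpow_pos_of_pos hD _).ne'
    have h2 : D ^ (γ - 1) ≠ 0 := (Real.rpow_pos_of_pos hD _).ne'
    calc _ = -((q ^ 2 * (q ^ 2) ^ a * q ^ (γ - 1)) / (D ^ 2 * D ^ a * D ^ a * D ^ (γ - 1)) *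
          (z ^ a * (1 - z) ^ a * oddKernel γ (1 / (1 + q) - z))) := by
          field_simp
      _ = _ := by rw [e1, e2]; ring
  rw [setIntegral_congr_fun measurableSet_Ioo hpt, integral_neg] at hcv
  linarith

/-! ### The Beta law: constant potential and density -/

theorem betaPDFReal_eq_indicator (α β : ℝ) : ProbabilityTheory.betaPDFReal α β =
    (Set.Ioo (0 : ℝ) 1).indicator
      (fun y => 1 / ProbabilityTheory.beta α β * y ^ (α - 1) * (1 - y) ^ (β - 1)) := by
  funext x
  simp only [ProbabilityTheory.betaPDFReal, Set.indicator, Set.mem_Ioo]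

theorem integral_betaMeasure {α β : ℝ} (hα : 0 < α) (hβ : 0 < β) (g : ℝ → ℝ) :
    ∫ y, g y ∂(ProbabilityTheory.betaMeasure α β) = 1 / ProbabilityTheory.beta α β *
      ∫ y in Set.Ioo (0 : ℝ) 1, y ^ (α - 1) * (1 - y) ^ (β - 1) * g y := by
  rw [ProbabilityTheory.betaMeasure, integral_withDensity_eq_integral_toReal_smul,
    ← integral_const_mul, ← integral_indicator measurableSet_Ioo]
  · refine integral_congr_ae (Eventually.of_forall fun y => ?_)
    simp only [ProbabilityTheory.betaPDF, betaPDFReal_eq_indicator, smul_eq_mul]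
    by_cases hy : y ∈ Set.Ioo (0 : ℝ) 1
    · have h1 := hy.1
      have h2 : 0 < 1 - y := sub_pos.2 hy.2
      have h3 := ProbabilityTheory.beta_pos hα hβ
      rw [Set.indicator_of_mem hy, Set.indicator_of_mem hy, ENNReal.toReal_ofReal (by positivity)]
      ring
    · simp [Set.indicator_of_notMem hy]
  · exact (ProbabilityTheory.measurable_betaPDFReal α β).ennreal_ofReal
  · exact Eventually.of_forall fun _ => ENNReal.ofReal_lt_top

theorem ae_betaMeasure_mem_Icc (α β : ℝ) :
    ∀ᵐ x ∂(ProbabilityTheory.betaMeasure α β), x ∈ Set.Icc (0 : ℝ) 1 := by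
  rw [ProbabilityTheory.betaMeasure, ae_withDensity_iff
    (by exact (ProbabilityTheory.measurable_betaPDFReal α β).ennreal_ofReal)]
  refine Eventually.of_forall fun x hx => ?_
  by_contra h
  refine hx ?_
  simp only [ProbabilityTheory.betaPDF, betaPDFReal_eq_indicator]
  rw [Set.indicator_of_notMem fun h' => h (Set.Ioo_subset_Icc_self h'), ENNReal.ofReal_zero]

/-- The `γ`-potential of the Beta distribution is constant on `[0, 1]`. -/
theorem integral_abs_sub_rpow_betaMeasure {γ : ℝ} (hγ₀ : 0 < γ) (hγ₁ : γ < 1) {x : ℝ}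
    (hx : x ∈ Set.Icc (0 : ℝ) 1) :
    ∫ y, |x - y| ^ γ ∂(ProbabilityTheory.betaMeasure ((1 - γ) / 2) ((1 - γ) / 2)) =
      ∫ y, |y| ^ γ ∂(ProbabilityTheory.betaMeasure ((1 - γ) / 2) ((1 - γ) / 2)) := by
  have hα : 0 < (1 - γ) / 2 := half_pos (sub_pos.2 hγ₁)
  have := ProbabilityTheory.isProbabilityMeasureBeta hα hα
  have hsupp := ae_betaMeasure_mem_Icc ((1 - γ) / 2) ((1 - γ) / 2)
  have hzero : ∀ s ∈ Set.Ioo (0 : ℝ) 1, ∫ y, oddKernel γ (s - y)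
      ∂(ProbabilityTheory.betaMeasure ((1 - γ) / 2) ((1 - γ) / 2)) = 0 := by
    intro s hs
    rw [integral_betaMeasure hα hα]
    have h := integral_rpow_mul_oddKernel_eq_zero γ hs
    rw [show -(1 + γ) / 2 = (1 - γ) / 2 - 1 by ring] at h
    rw [h, mul_zero]
  set β := ProbabilityTheory.betaMeasure ((1 - γ) / 2) ((1 - γ) / 2) with hβ
  have hbdd (x : ℝ) (hx : x ∈ Set.Icc (0 : ℝ) 1) : Integrable (fun y => |x - y| ^ γ) β := by
    refine Integrable.of_bound (C := 1)
      (Measurable.aestronglyMeasurable (by fun_prop)) ?_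
    filter_upwards [hsupp] with y hy
    rw [Real.norm_of_nonneg (by positivity)]
    refine Real.rpow_le_one (abs_nonneg _) ?_ hγ₀.le
    rw [abs_le]; constructor <;> linarith [hx.1, hx.2, hy.1, hy.2]
  -- Needed for Fubini. Since `s - y` lies in `[-1, 1]`, the kernel may be cut off there and becomes
  -- integrable; its convolution integrand with the constant `1` is then integrable.
  have hprod : Integrable (fun p : ℝ × ℝ => oddKernel γ (p.1 - p.2))
      ((volume.restrict (Set.Ioc 0 x)).prod β) := by
    have hloc : Integrable ((Set.Icc (-1 : ℝ) 1).indicator (oddKernel γ)) :=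
      (integrable_indicator_iff measurableSet_Icc).2
        ((locallyIntegrable_oddKernel hγ₀).integrableOn_isCompact isCompact_Icc)
    have hconv := Integrable.convolution_integrand (ContinuousLinearMap.mul ℝ ℝ)
      (integrable_const (μ := β) (1 : ℝ)) hloc
    have hconv' := hconv.mono_measure
      (Measure.prod_mono (Measure.restrict_le_self (s := Set.Ioc 0 x)) le_rfl)
    refine hconv'.congr ?_
    have h1 : ∀ᵐ p ∂((volume.restrict (Set.Ioc 0 x)).prod β), p.1 ∈ Set.Ioc 0 x :=
      Measure.quasiMeasurePreserving_fst.ae (ae_restrict_mem measurableSet_Ioc)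
    have h2 : ∀ᵐ p ∂((volume.restrict (Set.Ioc 0 x)).prod β), p.2 ∈ Set.Icc (0 : ℝ) 1 :=
      Measure.quasiMeasurePreserving_snd.ae hsupp
    filter_upwards [h1, h2] with p hp hp2
    have hm : p.1 - p.2 ∈ Set.Icc (-1 : ℝ) 1 :=
      ⟨by linarith [hp.1, hp2.2], by linarith [hp.2, hx.2, hp2.1]⟩
    simp [Set.indicator_of_mem hm]
  have hswap := integral_integral_swap (f := fun s y : ℝ => oddKernel γ (s - y)) hprod
  have hleft : ∫ s in Set.Ioc 0 x, ∫ y, oddKernel γ (s - y) ∂β = 0 := by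
    -- The endpoint is dropped because `x` may be `1`, where `hzero` says nothing.
    rw [integral_Ioc_eq_integral_Ioo]
    refine setIntegral_eq_zero_of_forall_eq_zero fun s hs => hzero s ⟨hs.1, hs.2.trans_le hx.2⟩
  rw [hleft] at hswap
  have h0 : ∫ y, (|x - y| ^ γ - |y| ^ γ) ∂β = 0 := by
    have : ∀ y, |x - y| ^ γ - |y| ^ γ = γ * ∫ s in Set.Ioc 0 x, oddKernel γ (s - y) := fun y => by
      rw [← integral_oddKernel_sub hγ₀, intervalIntegral.integral_of_le hx.1]
    simp only [this, integral_const_mul, ← hswap, mul_zero]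
  rw [integral_sub (hbdd x hx) (by simpa using hbdd 0 (by simp))] at h0
  linarith

/-- Total mass one determines the normalising constant. -/
theorem beta_eq_integral {α β : ℝ} (hα : 0 < α) (hβ : 0 < β) :
    ProbabilityTheory.beta α β = ∫ t in (0 : ℝ)..1, t ^ (α - 1) * (1 - t) ^ (β - 1) := by
  have := ProbabilityTheory.isProbabilityMeasureBeta hα hβ
  have h := integral_betaMeasure hα hβ (fun _ => 1)
  have hb := (ProbabilityTheory.beta_pos hα hβ).ne'
  simp only [integral_const, probReal_univ, smul_eq_mul, mul_one] at h
  rw [intervalIntegral.integral_of_le zero_le_one, integral_Ioc_eq_integral_Ioo]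
  field_simp at h
  exact h

theorem betaDistribution_eq_withDensity {γ : ℝ} (hγ : 0 < (1 - γ) / 2) :
    (betaDistribution ((1 - γ) / 2) ((1 - γ) / 2) hγ hγ : Measure ℝ) =
      volume.withDensity (fun x : ℝ => ENNReal.ofReal
        ((Set.Ioo (0 : ℝ) 1).indicator
          (fun y : ℝ => y ^ (-(1 + γ) / 2) * (1 - y) ^ (-(1 + γ) / 2) /
            ∫ t in (0 : ℝ)..1, t ^ (-(1 + γ) / 2) * (1 - t) ^ (-(1 + γ) / 2)) x)) := by
  rw [show -(1 + γ) / 2 = (1 - γ) / 2 - 1 by ring, ← beta_eq_integral hγ hγ]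
  change volume.withDensity _ = _
  congr 1
  funext x
  simp only [ProbabilityTheory.betaPDF, betaPDFReal_eq_indicator]
  congr 3
  funext y
  ring

/-! ### Existence and uniqueness of optimal rewards -/

theorem isCompact_orderedRewards (n : ℕ) : IsCompact (orderedRewards n) := by
  have h : orderedRewards n =
      (⋂ (i : Fin n) (j : Fin n) (_ : i ≤ j), {r : Fin n → ℝ | r j ≤ r i}) ∩
        Set.univ.pi fun _ => Set.Icc (0 : ℝ) 1 := by
    ext r
    simp only [orderedRewards, Antitone, Set.mem_inter_iff, Set.mem_iInter, Set.mem_univ_pi,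
      Set.mem_ofPred_eq]
  rw [h]
  refine (isCompact_univ_pi fun _ => isCompact_Icc).inter_left ?_
  refine isClosed_iInter fun i => isClosed_iInter fun j => isClosed_iInter fun _ => ?_
  exact isClosed_le (continuous_apply j) (continuous_apply i)

theorem continuous_totalUtility {U : ℝ → ℝ} (hU : Continuous U) (n : ℕ) :
    Continuous (totalUtility U (n := n)) := by
  unfold totalUtility
  fun_prop

theorem exists_isOptimalReward {U : ℝ → ℝ} (hU : Continuous U) (n : ℕ) :
    ∃ r : Fin n → ℝ, IsOptimalReward U r := by
  obtain ⟨r, hr, hmax⟩ := (isCompact_orderedRewards n).exists_isMaxOn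
    ⟨fun _ => 0, antitone_const, fun _ => by simp⟩ (continuous_totalUtility hU n).continuousOn
  exact ⟨r, hr, hmax⟩

/-- Raising the top reward to `1` enlarges every difference that involves it, of which there is at
least one, and changes no other. -/
theorem isOptimalReward_zero_eq_one {U : ℝ → ℝ} (hU : StrictMonoOn U (Set.Ici 0)) {n : ℕ}
    {r : Fin (n + 2) → ℝ} (hr : IsOptimalReward U r) : r 0 = 1 := by
  by_contra hne
  have hlt : r 0 < 1 := lt_of_le_of_ne (hr.1.2 0).2 hne
  have hmem : Function.update r 0 1 ∈ orderedRewards (n + 2) := by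
    refine ⟨fun i j hij => ?_, fun i => ?_⟩
    · rcases eq_or_ne i 0 with rfl | hi
      · rcases eq_or_ne j 0 with rfl | hj
        · simp
        · simpa [Function.update_of_ne hj] using (hr.1.2 j).2
      · have hj : j ≠ 0 := fun h => hi (le_antisymm (h ▸ hij) (Fin.zero_le i))
        rw [Function.update_of_ne hi, Function.update_of_ne hj]
        exact hr.1.1 hij
    · rcases eq_or_ne i 0 with rfl | hi
      · simp
      · rw [Function.update_of_ne hi]; exact hr.1.2 i
  have hlt' : totalUtility U r < totalUtility U (Function.update r 0 1) := by
    refine Finset.sum_lt_sum (fun i _ => ?_) ⟨0, Finset.mem_univ _, ?_⟩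
    · rcases eq_or_ne i 0 with rfl | hi
      · refine Finset.sum_le_sum fun j hj => ?_
        have hj0 : j ≠ 0 := (Finset.mem_Ioi.1 hj).ne'
        rw [Function.update_self, Function.update_of_ne hj0]
        have := hr.1.1 (Fin.zero_le j)
        exact hU.monotoneOn (sub_nonneg.2 this) (sub_nonneg.2 (hr.1.2 j).2) (by linarith)
      · refine (Finset.sum_congr rfl fun j hj => ?_).le
        have hj0 : j ≠ 0 := ((Fin.zero_le i).trans_lt (Finset.mem_Ioi.1 hj)).ne'
        rw [Function.update_of_ne hi, Function.update_of_ne hj0]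
    · refine Finset.sum_lt_sum_of_nonempty ⟨1, by simp⟩ fun j hj => ?_
      have hj0 : j ≠ 0 := (Finset.mem_Ioi.1 hj).ne'
      rw [Function.update_self, Function.update_of_ne hj0]
      have := hr.1.1 (Fin.zero_le j)
      exact hU (sub_nonneg.2 this) (sub_nonneg.2 (hr.1.2 j).2) (by linarith)
  exact absurd (hr.2 hmem) (not_le.2 hlt')

/-- The utility is translation invariant, hence not strictly concave in `r`. With both top rewards
equal to `1`, a coordinate `k` where the solutions differ gives distinct differences from the top,
and their midpoint does strictly better. -/
theorem IsOptimalReward.unique {U : ℝ → ℝ} (hmono : StrictMonoOn U (Set.Ici 0))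
    (hconc : StrictConcaveOn ℝ (Set.Ici 0) U) {n : ℕ} {r s : Fin (n + 2) → ℝ}
    (hr : IsOptimalReward U r) (hs : IsOptimalReward U s) : r = s := by
  by_contra hne
  obtain ⟨k, hk⟩ := Function.ne_iff.1 hne
  have hr0 := isOptimalReward_zero_eq_one hmono hr
  have hs0 := isOptimalReward_zero_eq_one hmono hs
  have hk0 : k ≠ 0 := by rintro rfl; exact hk (hr0.trans hs0.symm)
  have heq : totalUtility U r = totalUtility U s := le_antisymm (hs.2 hr.1) (hr.2 hs.1)
  let m : Fin (n + 2) → ℝ := fun i => (1 / 2 : ℝ) * r i + (1 / 2 : ℝ) * s i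
  have hm : m ∈ orderedRewards (n + 2) := by
    refine ⟨fun i j hij => ?_, fun i => ?_⟩
    · have h1 := hr.1.1 hij
      have h2 := hs.1.1 hij
      simp only [m]
      linarith
    · have h1 := hr.1.2 i
      have h2 := hs.1.2 i
      exact ⟨by simp only [m]; linarith [h1.1, h2.1], by simp only [m]; linarith [h1.2, h2.2]⟩
  have hdiff (i j : Fin (n + 2)) : m i - m j =
      (1 / 2 : ℝ) • (r i - r j) + (1 / 2 : ℝ) • (s i - s j) := by
    simp only [m, smul_eq_mul]; ring
  have hle (i j : Fin (n + 2)) (hij : i ≤ j) :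
      1 / 2 * U (r i - r j) + 1 / 2 * U (s i - s j) ≤ U (m i - m j) := by
    rw [hdiff]
    exact hconc.concaveOn.2 (sub_nonneg.2 (hr.1.1 hij)) (sub_nonneg.2 (hs.1.1 hij))
      (by norm_num) (by norm_num) (by norm_num)
  have hlt : 1 / 2 * U (r 0 - r k) + 1 / 2 * U (s 0 - s k) < U (m 0 - m k) := by
    rw [hdiff]
    refine hconc.2 (sub_nonneg.2 (hr.1.1 (Fin.zero_le k))) (sub_nonneg.2 (hs.1.1 (Fin.zero_le k)))
      (fun h => hk ?_) (by norm_num) (by norm_num) (by norm_num)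
    linarith
  have hsum : 1 / 2 * totalUtility U r + 1 / 2 * totalUtility U s < totalUtility U m := by
    simp only [totalUtility, Finset.mul_sum, ← Finset.sum_add_distrib]
    refine Finset.sum_lt_sum (fun i _ => Finset.sum_le_sum fun j hj =>
      hle i j (Finset.mem_Ioi.1 hj).le) ⟨0, Finset.mem_univ _, ?_⟩
    exact Finset.sum_lt_sum (fun j hj => hle 0 j (Finset.mem_Ioi.1 hj).le)
      ⟨k, Finset.mem_Ioi.2 (Fin.pos_of_ne_zero hk0), hlt⟩
  have := hr.2 hm
  simp only [Set.mem_ofPred_eq] at this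
  linarith

theorem existsUnique_isOptimalReward {γ : ℝ} (hγ₀ : 0 < γ) (hγ₁ : γ < 1) {n : ℕ} (hn : 2 ≤ n) :
    ∃! r : Fin n → ℝ, IsOptimalReward (fun x : ℝ => x ^ γ) r := by
  obtain ⟨m, rfl⟩ := Nat.exists_eq_add_of_le' hn
  obtain ⟨r, hr⟩ := exists_isOptimalReward (Real.continuous_rpow_const hγ₀.le) (m + 2)
  exact ⟨r, hr, fun s hs => IsOptimalReward.unique (Real.strictMonoOn_rpow_Ici_of_exponent_pos hγ₀)
    (Real.strictConcaveOn_rpow hγ₀ hγ₁) hs hr⟩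

/-! ### Energy of optimal configurations -/

theorem sum_sum_abs_sub_rpow {γ : ℝ} (hγ₀ : 0 < γ) {n : ℕ} {r : Fin n → ℝ} (hr : Antitone r) :
    ∑ i, ∑ j, |r i - r j| ^ γ = 2 * totalUtility (fun x : ℝ => x ^ γ) r := by
  have h1 : ∀ i, ∑ j, |r i - r j| ^ γ = ∑ j ∈ {i}ᶜ, |r j - r i| ^ γ := fun i => by
    rw [← Finset.sum_compl_add_sum {i}]
    simp [Real.zero_rpow hγ₀.ne', abs_sub_comm]
  simp only [h1]
  rw [← Finset.sum_sum_Ioi_add_eq_sum_sum_off_diag (fun i j => |r i - r j| ^ γ)]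
  rw [totalUtility, Finset.mul_sum]
  refine Finset.sum_congr rfl fun i _ => ?_
  rw [Finset.mul_sum]
  refine Finset.sum_congr rfl fun j hj => ?_
  have := hr (Finset.mem_Ioi.1 hj).le
  rw [abs_sub_comm (r j), abs_of_nonneg (sub_nonneg.2 this)]
  ring

theorem integrable_abs_sub_rpow {γ : ℝ} (hγ₀ : 0 < γ) {μ ν : Measure ℝ} [IsProbabilityMeasure μ]
    [IsProbabilityMeasure ν] (hμ : ∀ᵐ x ∂μ, x ∈ Set.Icc (0 : ℝ) 1)
    (hν : ∀ᵐ x ∂ν, x ∈ Set.Icc (0 : ℝ) 1) :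
    Integrable (fun p : ℝ × ℝ => |p.1 - p.2| ^ γ) (μ.prod ν) := by
  refine Integrable.of_bound (C := 1) (Measurable.aestronglyMeasurable (by fun_prop)) ?_
  filter_upwards [ae_prod_abs_sub_le_one hμ hν] with p hp
  rw [Real.norm_of_nonneg (by positivity)]
  exact Real.rpow_le_one (abs_nonneg _) hp hγ₀.le

theorem measurePreserving_eval_pair (μ : Measure ℝ) [IsProbabilityMeasure μ] {N : ℕ} {i j : Fin N}
    (hij : i ≠ j) : MeasurePreserving (fun x : Fin N → ℝ => (x i, x j))
      (Measure.pi fun _ => μ) (μ.prod μ) := by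
  refine ⟨by fun_prop, ?_⟩
  have h := (ProbabilityTheory.iIndepFun_pi (μ := fun _ : Fin N => μ) (X := fun _ x => x)
    fun _ => aemeasurable_id).indepFun hij
  rw [ProbabilityTheory.indepFun_iff_map_prod_eq_prod_map_map
    (measurable_pi_apply i).aemeasurable (measurable_pi_apply j).aemeasurable] at h
  rw [h, (measurePreserving_eval (fun _ : Fin N => μ) i).map_eq,
    (measurePreserving_eval (fun _ : Fin N => μ) j).map_eq]

/-- Some configuration of points has at least the mean energy of independent points. -/
theorem exists_energy_le_sum_sum {γ : ℝ} (hγ₀ : 0 < γ) {μ : Measure ℝ} [IsProbabilityMeasure μ]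
    (hμ : ∀ᵐ x ∂μ, x ∈ Set.Icc (0 : ℝ) 1) (N : ℕ) :
    ∃ x : Fin N → ℝ, (∀ i, x i ∈ Set.Icc (0 : ℝ) 1) ∧
      N * (N - 1) * energy γ μ μ ≤ ∑ i, ∑ j, |x i - x j| ^ γ := by
  have hint : ∀ i j : Fin N, Integrable (fun x : Fin N → ℝ => |x i - x j| ^ γ)
      (Measure.pi fun _ => μ) := fun i j => by
    rcases eq_or_ne i j with rfl | hij
    · simp
    · exact (measurePreserving_eval_pair μ hij).integrable_comp_of_integrable
        (integrable_abs_sub_rpow hγ₀ hμ hμ)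
  have hval : ∀ i j : Fin N, ∫ x : Fin N → ℝ, |x i - x j| ^ γ ∂(Measure.pi fun _ => μ) =
      if i = j then 0 else energy γ μ μ := fun i j => by
    split_ifs with hij
    · simp [hij, Real.zero_rpow hγ₀.ne']
    · have hmp := measurePreserving_eval_pair μ hij
      rw [energy, ← hmp.map_eq, integral_map hmp.measurable.aemeasurable
        (Measurable.aestronglyMeasurable (by fun_prop))]
  have hsupp : ∀ᵐ x ∂(Measure.pi fun _ : Fin N => μ), ∀ i, x i ∈ Set.Icc (0 : ℝ) 1 :=
    ae_all_iff.2 fun i => (measurePreserving_eval (fun _ : Fin N => μ) i).quasiMeasurePreserving.ae hμ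
  -- A sample at or above the mean, chosen off the null set of samples leaving `[0, 1]`.
  obtain ⟨x, hx, hle⟩ := exists_notMem_null_integral_le
    (integrable_finsetSum Finset.univ fun i _ => integrable_finsetSum Finset.univ
      fun j _ => hint i j) (ae_iff.1 hsupp)
  refine ⟨x, by simpa using hx, le_trans (le_of_eq ?_) hle⟩
  rw [integral_finsetSum _ fun i _ => integrable_finsetSum _ fun j _ => hint i j]
  simp only [integral_finsetSum _ fun j _ => hint _ j, hval]
  have : ∀ i : Fin N, (∑ j, if i = j then 0 else energy γ μ μ) = (N - 1) * energy γ μ μ :=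
    fun i => by
      have h : ∀ j, (if i = j then 0 else energy γ μ μ) =
          energy γ μ μ - if i = j then energy γ μ μ else 0 := fun j => by split_ifs <;> simp
      simp only [h, Finset.sum_sub_distrib]
      simp
      ring
  simp only [this]
  simp
  ring

/-- The double sum is invariant under permutations, so the points may be sorted. -/
theorem exists_antitone_sum_sum_eq {γ : ℝ} {N : ℕ} {x : Fin N → ℝ}
    (hx : ∀ i, x i ∈ Set.Icc (0 : ℝ) 1) :
    ∃ r ∈ orderedRewards N, ∑ i, ∑ j, |r i - r j| ^ γ = ∑ i, ∑ j, |x i - x j| ^ γ := by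
  let σ := Tuple.sort fun i => -x i
  refine ⟨x ∘ σ, ⟨fun i j hij => ?_, fun i => hx _⟩, ?_⟩
  · simpa using Tuple.monotone_sort (fun i => -x i) hij
  · simp only [Function.comp_apply]
    rw [Equiv.sum_comp σ fun i => ∑ j, |x i - x (σ j)| ^ γ]
    exact Finset.sum_congr rfl fun i _ => Equiv.sum_comp σ fun j => |x i - x j| ^ γ

theorem IsOptimalReward.energy_le {γ : ℝ} (hγ₀ : 0 < γ) {μ : Measure ℝ} [IsProbabilityMeasure μ]
    (hμ : ∀ᵐ x ∂μ, x ∈ Set.Icc (0 : ℝ) 1) {N : ℕ} {r : Fin N → ℝ}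
    (hr : IsOptimalReward (fun x : ℝ => x ^ γ) r) :
    N * (N - 1) * energy γ μ μ ≤ ∑ i, ∑ j, |r i - r j| ^ γ := by
  obtain ⟨x, hx, hle⟩ := exists_energy_le_sum_sum hγ₀ hμ N
  obtain ⟨s, hs, heq⟩ := exists_antitone_sum_sum_eq (γ := γ) hx
  have := hr.2 hs
  simp only [Set.mem_ofPred_eq] at this
  rw [← heq, sum_sum_abs_sub_rpow hγ₀ hs.1] at hle
  rw [sum_sum_abs_sub_rpow hγ₀ hr.1.1]
  linarith

theorem integral_empiricalMeasure {N : ℕ} (r : Fin N → ℝ) (f : ℝ → ℝ) :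
    ∫ x, f x ∂(empiricalMeasure r) = (N : ℝ)⁻¹ * ∑ i, f (r i) := by
  rw [empiricalMeasure, integral_smul_measure, integral_finsetSum_measure
    fun i _ => integrable_dirac (by simp)]
  simp

theorem ae_empiricalMeasure {N : ℕ} {r : Fin N → ℝ} (hr : ∀ i, r i ∈ Set.Icc (0 : ℝ) 1) :
    ∀ᵐ x ∂(empiricalMeasure r), x ∈ Set.Icc (0 : ℝ) 1 := by
  rw [ae_iff]
  change empiricalMeasure r (Set.Icc (0 : ℝ) 1)ᶜ = 0
  rw [empiricalMeasure, Measure.smul_apply, Measure.finsetSum_apply]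
  simp only [Measure.dirac_apply' _ measurableSet_Icc.compl]
  simp [hr]

theorem energy_empiricalMeasure {γ : ℝ} (hγ₀ : 0 < γ) {N : ℕ} [NeZero N] {r : Fin N → ℝ}
    (hr : ∀ i, r i ∈ Set.Icc (0 : ℝ) 1) :
    energy γ (empiricalMeasure r) (empiricalMeasure r) =
      (∑ i, ∑ j, |r i - r j| ^ γ) / (N : ℝ) ^ 2 := by
  have := isProbabilityMeasure_empiricalMeasure r
  have hs := ae_empiricalMeasure hr
  rw [energy, integral_prod _ (integrable_abs_sub_rpow hγ₀ hs hs)]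
  simp only [integral_empiricalMeasure, ← Finset.mul_sum]
  field_simp

/-- The potential is constant, so the value does not depend on `μ`; two Beta terms of the energy
distance therefore combine into one constant. -/
theorem energy_betaMeasure {γ : ℝ} (hγ₀ : 0 < γ) (hγ₁ : γ < 1) {μ : Measure ℝ}
    [IsProbabilityMeasure μ] (hμ : ∀ᵐ x ∂μ, x ∈ Set.Icc (0 : ℝ) 1) :
    energy γ μ (ProbabilityTheory.betaMeasure ((1 - γ) / 2) ((1 - γ) / 2)) =
      ∫ y, |y| ^ γ ∂(ProbabilityTheory.betaMeasure ((1 - γ) / 2) ((1 - γ) / 2)) := by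
  have hα : 0 < (1 - γ) / 2 := half_pos (sub_pos.2 hγ₁)
  have := ProbabilityTheory.isProbabilityMeasureBeta hα hα
  rw [energy, integral_prod _ (integrable_abs_sub_rpow hγ₀ hμ (ae_betaMeasure_mem_Icc _ _))]
  rw [integral_congr_ae (g := fun _ => ∫ y, |y| ^ γ
    ∂(ProbabilityTheory.betaMeasure ((1 - γ) / 2) ((1 - γ) / 2)))]
  · simp
  · filter_upwards [hμ] with x hx
    exact integral_abs_sub_rpow_betaMeasure hγ₀ hγ₁ hx

/-! ### Weak convergence -/

theorem tendsto_charFun_of_forall_pos {μ : ℕ → Measure ℝ} {ν : Measure ℝ}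
    [∀ n, IsProbabilityMeasure (μ n)] [IsProbabilityMeasure ν]
    (h : ∀ t > 0, Tendsto (fun n => charFun (μ n) t) atTop (𝓝 (charFun ν t))) (t : ℝ) :
    Tendsto (fun n => charFun (μ n) t) atTop (𝓝 (charFun ν t)) := by
  rcases lt_trichotomy t 0 with ht | rfl | ht
  · have := (Complex.continuous_conj.tendsto _).comp (h (-t) (neg_pos.2 ht))
    simpa [Function.comp_def, charFun_neg] using this
  · simp
  · exact h t ht

theorem tendsto_empiricalDistribution {γ : ℝ} (hγ₀ : 0 < γ) (hγ₁ : γ < 1)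
    (hα : 0 < (1 - γ) / 2) {r : (n : ℕ) → Fin (n + 1) → ℝ}
    (hr : ∀ n : ℕ, IsOptimalReward (fun x : ℝ => x ^ γ) (r n)) :
    Tendsto (fun n : ℕ => empiricalDistribution (r n)) atTop
      (𝓝 (betaDistribution ((1 - γ) / 2) ((1 - γ) / 2) hα hα)) := by
  rw [ProbabilityMeasure.tendsto_iff_tendsto_charFun]
  refine tendsto_charFun_of_forall_pos (μ := fun n => (empiricalDistribution (r n) : Measure ℝ))
    (ν := betaDistribution ((1 - γ) / 2) ((1 - γ) / 2) hα hα) fun t ht => ?_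
  change Tendsto (fun n => charFun (empiricalMeasure (r n)) t) atTop
    (𝓝 (charFun (ProbabilityTheory.betaMeasure ((1 - γ) / 2) ((1 - γ) / 2)) t))
  have hβ := ProbabilityTheory.isProbabilityMeasureBeta hα hα
  have hsβ := ae_betaMeasure_mem_Icc ((1 - γ) / 2) ((1 - γ) / 2)
  have hββ := energy_betaMeasure hγ₀ hγ₁ hsβ
  set β := ProbabilityTheory.betaMeasure ((1 - γ) / 2) ((1 - γ) / 2)
  set C := ∫ y, |y| ^ γ ∂β
  set A := 16 * (t + 1) ^ (1 + γ) * cosConstant γ with hA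
  have hA0 : 0 ≤ A := by
    have := cosConstant_pos hγ₀ hγ₁
    positivity
  -- The vector `r n` has `n + 1` entries, and the missing diagonal pairs cost a fraction `1 / (n +
  -- 1)` of the energy `C`.
  have hbound : ∀ n : ℕ,
      ‖charFun (empiricalMeasure (r n)) t - charFun β t‖ ^ 3 ≤ A * C * (1 / ((n : ℝ) + 1)) := by
    intro n
    have := isProbabilityMeasure_empiricalMeasure (r n)
    have hs := ae_empiricalMeasure (hr n).1.2
    have h := norm_charFun_sub_pow_three_le hγ₀ hγ₁ hs hsβ ht
    rw [energy_betaMeasure hγ₀ hγ₁ hs, hββ, energy_empiricalMeasure hγ₀ (hr n).1.2] at h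
    have hE := (hr n).energy_le hγ₀ hsβ
    rw [hββ] at hE
    push_cast at hE h
    have hn : (0 : ℝ) < (n : ℝ) + 1 := by positivity
    have hdiv : C - (∑ i, ∑ j, |r n i - r n j| ^ γ) / ((n : ℝ) + 1) ^ 2 ≤
        C * (1 / ((n : ℝ) + 1)) := by
      have : C * (1 - 1 / ((n : ℝ) + 1)) ≤
          (∑ i, ∑ j, |r n i - r n j| ^ γ) / ((n : ℝ) + 1) ^ 2 := by
        rw [le_div_iff₀ (by positivity)]
        refine le_trans (le_of_eq ?_) hE
        field_simp
      linarith
    calc _ ≤ _ := h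
      _ = A * (C - (∑ i, ∑ j, |r n i - r n j| ^ γ) / ((n : ℝ) + 1) ^ 2) := by rw [hA]; ring
      _ ≤ A * (C * (1 / ((n : ℝ) + 1))) := by gcongr
      _ = _ := by ring
  have hcube : Tendsto (fun n : ℕ =>
      ‖charFun (empiricalMeasure (r n)) t - charFun β t‖ ^ 3) atTop (𝓝 0) := by
    refine squeeze_zero (fun n => by positivity) hbound ?_
    simpa using tendsto_one_div_add_atTop_nhds_zero_nat.const_mul (A * C)
  rw [tendsto_iff_norm_sub_tendsto_zero]
  have := hcube.rpow_const (p := (1 / 3 : ℝ)) (Or.inr (by norm_num))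
  rw [Real.zero_rpow (by norm_num)] at this
  refine this.congr fun n => ?_
  rw [← Real.rpow_natCast, ← Real.rpow_mul (norm_nonneg _)]
  norm_num

end RewardCollapse

theorem theorem1 (γ : ℝ) (hγ₀ : 0 < γ) (hγ₁ : γ < 1) :
    -- the ordered maximization problem has exactly one solution for every `n ≥ 2`
    (∀ n : ℕ, 2 ≤ n →
      ∃! r : Fin n → ℝ, RewardCollapse.IsOptimalReward (fun x : ℝ => x ^ γ) r) ∧
    -- the empirical distribution of its solutions converges weakly to the Beta distribution
    (∀ r : (n : ℕ) → Fin (n + 1) → ℝ,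
      (∀ n : ℕ, RewardCollapse.IsOptimalReward (fun x : ℝ => x ^ γ) (r n)) →
      Tendsto (fun n : ℕ => RewardCollapse.empiricalDistribution (r n)) atTop
        (𝓝 (RewardCollapse.betaDistribution ((1 - γ) / 2) ((1 - γ) / 2)
          (half_pos (sub_pos.mpr hγ₁)) (half_pos (sub_pos.mpr hγ₁))))) ∧
    -- the density of the limit
    (RewardCollapse.betaDistribution ((1 - γ) / 2) ((1 - γ) / 2)
        (half_pos (sub_pos.mpr hγ₁)) (half_pos (sub_pos.mpr hγ₁)) : Measure ℝ) =
      volume.withDensity (fun x : ℝ => ENNReal.ofReal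
        ((Set.Ioo (0 : ℝ) 1).indicator
          (fun y : ℝ => y ^ (-(1 + γ) / 2) * (1 - y) ^ (-(1 + γ) / 2) /
            ∫ t in (0 : ℝ)..1, t ^ (-(1 + γ) / 2) * (1 - t) ^ (-(1 + γ) / 2)) x)) := by
  exact ⟨fun n hn => RewardCollapse.existsUnique_isOptimalReward hγ₀ hγ₁ hn,
    fun r hr => RewardCollapse.tendsto_empiricalDistribution hγ₀ hγ₁ _ hr,
    RewardCollapse.betaDistribution_eq_withDensity _⟩
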